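/- Let $\mathcal A$ be a set of agents, $\mathcal I$ a set of institutions, and $\mathcal X$ a finite set of contracts. Each $x\in\mathcal X$ has an agent $\alpha(x)\in\mathcal A$ and an institution in $\mathcal I$. For $X\subseteq\mathcal X$ let $X_a$ and $X_i$ be the sets of contracts in $X$ of agent $a$ and of institution $i$. Each institution $i$ has a capacity $q_i\in\mathbb N$, a linear priority order $\succ_i$ on $\mathcal X_i$, and a matroid $(\mathcal X_i,\mathcal F_i)$ with rank function $r_i$ all of whose independent sets have cardinality at most $q_i$. A matching is a set $X\subseteq\mathcal X$ with $|X_a|\le 1$ for every agent $a$. A problem is a profile $R=(R_a)_{a\in\mathcal A}$, where $R_a$ is a linear order on $\mathcal X_a\cup\{\emptyset\}$ with strict part $P_a$, and $\emptyset$ is the null contract; $x$ is acceptable if $x\mathrel{R_a}\emptyset$. For a matching $X$ we also write $X_a\in\mathcal X_a\cup\{\emptyset\}$ for the assignment of $a$. A matching rule $\varphi$ assigns a matching $\varphi(R)$ to every problem $R$. The non-wasteful matroid choice rule $C^m_i$ of institution $i$ chooses from $Y\subseteq\mathcal X_i$ as follows. Step 1 (greedy rule): go through $Y$ from the highest to the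 lowest priority, and add a contract to the chosen set whenever the resulting set is in $\mathcal F_i$. Step 2: add the remaining contracts of $Y$ in order of priority until $q_i$ contracts are chosen or all of $Y$ is chosen. DA based on $(C^m_i)_{i\in\mathcal I}$ is the matching rule given by the deferred-acceptance algorithm: at each step, each agent without a tentatively accepted contract proposes its most preferred acceptable contract that has not yet been rejected (if there is one); each institution $i$ applies $C^m_i$ to its tentatively accepted contracts together with the new proposals, tentatively accepts the chosen ones and permanently rejects the others. The algorithm stops at the first step without a rejection, and the contracts then tentatively accepted form the outcome. **Corollary.** A matching rule $\varphi$ is DA based on $(C^m_i)_{i\in\mathcal I}$ if and only if $\varphi$ is strategy-proof, i.e. $\varphi_a(R)\mathrel{R_a}\varphi_a(R'_a,R_{-a})$ for all $R$, $a$ and $R'_a$, and for every problem $R$ the matching $X=\varphi(R)$ satisfies: - non-wastefulness: for every $i$, $|X_i|\le q_i$, and if some $x\in\mathcal X_i$ has $x\mathrel{P_{\alpha(x)}}X_{\alpha(x)}$, then $|X_i|=q_i$; - no justified envy under rank: for every $i$, $x\in X_i$ and $y\in\mathcal X_i\setminus X_i$ with $y\mathrel{P_{\alpha(y)}}X_{\alpha(y)}$,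 if $y\succ_i x$ then $r_i((X_i\setminus\{x\})\cup\{y\})<r_i(X_i)$; - matroidal objectives: for every $i$ and $x\in\mathcal X_i\setminus X_i$ with $x\mathrel{P_{\alpha(x)}}X_{\alpha(x)}$, $r_i(X_i\cup\{x\})=r_i(X_i)$; - individual rationality: $X_a\mathrel{R_a}\emptyset$ for every agent $a$. -/

import Mathlib

namespace MatroidDA

noncomputable section

open Classical

/-- A linear order, written as "weakly better than": `R.ge x y` means that `x` is at least as good
as (or has weakly higher priority than) `y`. -/
structure LinPref (T : Type*) where
  ge : T → T → Prop
  linear : IsLinearOrder T ge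

/-- The strict part of a linear order. -/
def LinPref.gt {T : Type*} (R : LinPref T) (x y : T) : Prop :=
  R.ge x y ∧ x ≠ y

instance {T : Type*} (R : LinPref T) : IsLinearOrder T R.ge := R.linear

/-- The elements of `Y`, listed from the highest to the lowest. -/
def LinPref.ranking {T : Type*} (R : LinPref T) (Y : Finset T) : List T :=
  Y.sort R.ge

section Choice

variable {T : Type*}

/-- A choice rule on a set `T` of contracts: it selects a subset of each choice problem. -/
structure ChoiceRule (T : Type*) where
  choose : Finset T → Finset T
  choose_subset : ∀ Y, choose Y ⊆ Y

/-- One step of the greedy choice rule. -/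
def greedyStep (M : Matroid T) (S : Finset T) (x : T) : Finset T :=
  if M.Indep (insert x S : Finset T) then insert x S else S

/-- The greedy choice rule: the contracts of `Y` are considered from the highest to the lowest
priority, and each is added whenever this keeps the chosen set independent. -/
def greedy (M : Matroid T) (prio : LinPref T) (Y : Finset T) : Finset T :=
  (prio.ranking Y).foldl (greedyStep M) ∅

/-- The contracts chosen by the non-wasteful matroid choice rule with capacity `q`: first apply the
greedy rule, then fill the remaining seats with the remaining contracts of highest priority until
all seats are filled or all contracts are chosen. -/
def matroidChoose (M : Matroid T) (prio : LinPref T) (q : ℕ) (Y : Finset T) : Finset T :=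
  greedy M prio Y ∪
    ((prio.ranking (Y \ greedy M prio Y)).take (q - (greedy M prio Y).card)).toFinset

theorem foldl_greedyStep_subset (M : Matroid T) (l : List T) (S Y : Finset T)
    (hS : S ⊆ Y) (hl : ∀ x ∈ l, x ∈ Y) : l.foldl (greedyStep M) S ⊆ Y := by
  induction l generalizing S with
  | nil => simpa using hS
  | cons x l ih =>
    rw [List.foldl_cons]
    refine ih _ ?_ fun y hy => hl y (List.mem_cons_of_mem _ hy)
    unfold greedyStep
    split_ifs
    · exact Finset.insert_subset (hl x List.mem_cons_self) hS
    · exact hS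

theorem greedy_subset (M : Matroid T) (prio : LinPref T) (Y : Finset T) :
    greedy M prio Y ⊆ Y :=
  foldl_greedyStep_subset M _ _ _ (Finset.empty_subset _) fun x hx => by
    simpa [LinPref.ranking] using hx

/-- The non-wasteful matroid choice rule. -/
def matroidChoice (M : Matroid T) (prio : LinPref T) (q : ℕ) : ChoiceRule T where
  choose := matroidChoose M prio q
  choose_subset Y := by
    refine Finset.union_subset (greedy_subset M prio Y) fun x hx => ?_
    have h := List.mem_of_mem_take (List.mem_toFinset.1 hx)
    simp only [LinPref.ranking, Finset.mem_sort, Finset.mem_sdiff] at h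
    exact h.1

end Choice

/-- For `f = agent`, the set of contracts of agent `b`; for `f = inst`, the set of contracts of
institution `b`. -/
abbrev ContractsOf {X B : Type*} (f : X → B) (b : B) : Type _ := {x : X // f x = b}

/-- The contracts in `Z` that belong to `b`. -/
def part {X B : Type*} (f : X → B) (Z : Finset X) (b : B) : Finset (ContractsOf f b) :=
  Z.subtype fun x => f x = b

section Matchings

variable {A I X : Type*} (agent : X → A) (inst : X → I)

/-- A matching: a set of contracts with at most one contract for each agent. -/
structure Matching where
  contracts : Finset X
  card_le_one : ∀ a, (part agent contracts a).card ≤ 1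

/-- A matching problem: each agent has a linear order over its contracts and the null contract
`none`. -/
abbrev Problem := (a : A) → LinPref (Option (ContractsOf agent a))

/-- A matching rule associates a matching with each problem. -/
abbrev MatchingRule := Problem agent → Matching agent

variable {agent}

/-- The contract of agent `a` in the matching, `none` if the agent has no contract. -/
def Matching.assignment (Z : Matching agent) (a : A) : Option (ContractsOf agent a) :=
  if h : ∃ x : ContractsOf agent a, x.1 ∈ Z.contracts then some h.choose else none

/-- The agent of the contract `x` strictly prefers `x` to its assignment in `Z`. -/
def Prefers (R : Problem agent) (Z : Matching agent) (x : X) : Prop :=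
  (R (agent x)).gt (some ⟨x, rfl⟩) (Z.assignment (agent x))

/-- Individual rationality of a matching. -/
def IndividuallyRational (R : Problem agent) (Z : Matching agent) : Prop :=
  ∀ a, (R a).ge (Z.assignment a) none

/-- Non-wastefulness of a matching, for the capacities `q`. -/
def NonWasteful (q : I → ℕ) (R : Problem agent) (Z : Matching agent) : Prop :=
  ∀ i, (part inst Z.contracts i).card ≤ q i ∧
    ∀ x : ContractsOf inst i, Prefers R Z x.1 → (part inst Z.contracts i).card = q i

/-- Matroidal objectives of a matching: no institution can increase the rank of its contracts with
a contract whose agent prefers it to its assignment. -/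
def MatroidalObjectives (M : (i : I) → Matroid (ContractsOf inst i))
    (R : Problem agent) (Z : Matching agent) : Prop :=
  ∀ i, ∀ x : ContractsOf inst i, x ∉ part inst Z.contracts i → Prefers R Z x.1 →
    (M i).eRk (insert x (part inst Z.contracts i) : Finset _) =
      (M i).eRk (part inst Z.contracts i)

/-- No justified envy under rank of a matching. -/
def NoJustifiedEnvyUnderRank (M : (i : I) → Matroid (ContractsOf inst i))
    (prio : (i : I) → LinPref (ContractsOf inst i))
    (R : Problem agent) (Z : Matching agent) : Prop :=
  ∀ i, ∀ x ∈ part inst Z.contracts i, ∀ y : ContractsOf inst i,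
    y ∉ part inst Z.contracts i → Prefers R Z y.1 → (prio i).gt y x →
      (M i).eRk (insert y ((part inst Z.contracts i).erase x) : Finset _) <
        (M i).eRk (part inst Z.contracts i)

/-- Strategy-proofness of a matching rule. -/
def StrategyProof (φ : MatchingRule agent) : Prop :=
  ∀ (R : Problem agent) (a : A) (R' : LinPref (Option (ContractsOf agent a))),
    (R a).ge ((φ R).assignment a) ((φ (Function.update R a R')).assignment a)

theorem part_card_le_one_iff (Z : Finset X) (a : A) : (part agent Z a).card ≤ 1 ↔
    ∀ x ∈ Z, ∀ y ∈ Z, agent x = a → agent y = a → x = y := by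
  simp only [Finset.card_le_one, part, Finset.mem_subtype, Subtype.forall, Subtype.mk.injEq]
  exact ⟨fun h x hx y hy ha hb => h x ha hx y hb hy, fun h x ha hx y hb hy => h x hx y hy ha hb⟩

end Matchings

section DeferredAcceptance

variable {A I X : Type*} [Fintype X] {agent : X → A} {inst : X → I}

/-- A state of the deferred-acceptance algorithm: the tentatively accepted contracts and the
permanently rejected contracts. -/
structure DAState (X : Type*) where
  held : Finset X
  rejected : Finset X

/-- The new proposals: each agent without a tentatively accepted contract proposes its most
preferred acceptable contract among those not yet rejected, if there is one. -/
def newProposals (R : Problem agent) (s : DAState X) : Finset X :=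
  Finset.univ.filter fun x =>
    (∀ y ∈ s.held, agent y ≠ agent x) ∧ x ∉ s.rejected ∧
      (R (agent x)).ge (some ⟨x, rfl⟩) none ∧
      ∀ y : ContractsOf agent (agent x), y.1 ∉ s.rejected →
        (R (agent x)).ge (some ⟨x, rfl⟩) (some y)

/-- The contracts considered at a step: the tentatively accepted ones and the new proposals. -/
def considered (R : Problem agent) (s : DAState X) : Finset X :=
  s.held ∪ newProposals R s

/-- The contracts that are chosen from `Z` by their institutions. -/
def accepted (C : (i : I) → ChoiceRule (ContractsOf inst i)) (Z : Finset X) : Finset X :=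
  Z.filter fun x => (⟨x, rfl⟩ : ContractsOf inst (inst x)) ∈
    (C (inst x)).choose (part inst Z (inst x))

/-- One step of the deferred-acceptance algorithm. -/
def daStep (C : (i : I) → ChoiceRule (ContractsOf inst i)) (R : Problem agent)
    (s : DAState X) : DAState X where
  held := accepted C (considered R s)
  rejected := s.rejected ∪ (considered R s \ accepted C (considered R s))

/-- Run the deferred-acceptance algorithm from the state `s`: it stops after the first step in
which no further contract is rejected, and returns the tentatively accepted contracts. -/
def daRun (C : (i : I) → ChoiceRule (ContractsOf inst i)) (R : Problem agent)
    (s : DAState X) : Finset X :=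
  if (daStep C R s).rejected = s.rejected then (daStep C R s).held
  else daRun C R (daStep C R s)
termination_by Fintype.card X - s.rejected.card
decreasing_by
  have hsub : s.rejected ⊂ (daStep C R s).rejected :=
    Finset.ssubset_iff_subset_ne.2 ⟨Finset.subset_union_left, fun h => by simp_all⟩
  have h1 := Finset.card_lt_card hsub
  have h2 := Finset.card_le_univ (daStep C R s).rejected
  omega

/-- The outcome of the deferred-acceptance algorithm; at the beginning nothing is held and nothing
is rejected. -/
def daOutcome (C : (i : I) → ChoiceRule (ContractsOf inst i)) (R : Problem agent) : Finset X :=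
  daRun C R ⟨∅, ∅⟩

theorem daStep_held_card_le_one (C : (i : I) → ChoiceRule (ContractsOf inst i))
    (R : Problem agent) (s : DAState X) (hs : ∀ a, (part agent s.held a).card ≤ 1) (a : A) :
    (part agent (daStep C R s).held a).card ≤ 1 := by
  have key : ∀ x ∈ considered R s, ∀ y ∈ considered R s, agent x = a → agent y = a → x = y := by
    intro x hx y hy hxa hya
    have hs' := (part_card_le_one_iff s.held a).1 (hs a)
    simp only [considered, newProposals, Finset.mem_union, Finset.mem_filter, Finset.mem_univ,
      true_and] at hx hy
    rcases hx with hx | ⟨hx1, hx2, -, hx3⟩ <;> rcases hy with hy | ⟨hy1, hy2, -, hy3⟩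
    · exact hs' x hx y hy hxa hya
    · exact absurd (hxa.trans hya.symm) (hy1 x hx)
    · exact absurd (hya.trans hxa.symm) (hx1 y hy)
    · subst hxa
      have h1 := hx3 ⟨y, hya⟩ hy2
      have h2 : ∀ (b : A) (hb : agent y = b) (z : ContractsOf agent b), z.1 ∉ s.rejected →
          (R b).ge (some ⟨y, hb⟩) (some z) := by
        rintro b rfl z hz
        exact hy3 z hz
      have h3 := h2 _ hya ⟨x, rfl⟩ hx2
      have h4 := (R (agent x)).linear.antisymm _ _ h1 h3
      simpa using h4
  rw [part_card_le_one_iff]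
  intro x hx y hy
  exact key x (Finset.mem_filter.1 hx).1 y (Finset.mem_filter.1 hy).1

theorem daRun_card_le_one (C : (i : I) → ChoiceRule (ContractsOf inst i))
    (R : Problem agent) (s : DAState X) (hs : ∀ a, (part agent s.held a).card ≤ 1) (a : A) :
    (part agent (daRun C R s) a).card ≤ 1 := by
  induction s using daRun.induct C R with
  | case1 s h =>
    rw [daRun, if_pos h]
    exact daStep_held_card_le_one C R s hs a
  | case2 s h ih =>
    rw [daRun, if_neg h]
    exact ih (daStep_held_card_le_one C R s hs)

/-- The deferred-acceptance rule based on the choice rule profile `C`. -/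
def daRule (C : (i : I) → ChoiceRule (ContractsOf inst i)) : MatchingRule agent := fun R =>
  { contracts := daOutcome C R
    card_le_one := daRun_card_le_one C R ⟨∅, ∅⟩ fun a => by simp [part] }

end DeferredAcceptance

end

end MatroidDA

open MatroidDA

/-! Call a matching stable if it is individually rational and every institution, offered all
contracts that their agents weakly prefer to their assignments, chooses exactly the contracts it
holds. The axioms other than strategy-proofness amount to stability (`stable_matroidChoice_iff`),
since the three institutional ones pin down the chosen set (`matroidChoose_eq_iff`).

The matroid enters through `mem_greedy_iff`: the greedy rule picks a contract iff the available
contracts of higher priority do not span it. More competitors span more, which gives substitutes;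
filling the seats makes the choice from `Y` have size `min q |Y|`, which gives the law of aggregate
demand.

These two conditions suffice for the rest. Deferred acceptance is stable and agent-optimal, and all
stable matchings leave the same agents unmatched. Hence an agent who truncates its list just below a
contract that some stable matching gives it stays matched, at that contract or better. This yields
both the strategy-proofness of deferred acceptance and its uniqueness among stable strategy-proof
rules. -/

namespace MatroidDA

noncomputable section

open Classical

/-! ### Linear orders and their top segments -/

section Order

variable {T : Type*} (R : LinPref T)

theorem LinPref.ge_refl (x : T) : R.ge x x := R.linear.refl x

theorem LinPref.ge_trans {x y z : T} (h : R.ge x y) (h' : R.ge y z) : R.ge x z :=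
  R.linear.trans _ _ _ h h'

theorem LinPref.ge_antisymm {x y : T} (h : R.ge x y) (h' : R.ge y x) : x = y :=
  R.linear.antisymm _ _ h h'

theorem LinPref.ge_total (x y : T) : R.ge x y ∨ R.ge y x := R.linear.total x y

theorem LinPref.not_ge {x y : T} : ¬ R.ge x y ↔ R.gt y x := by
  constructor
  · intro h
    refine ⟨(R.ge_total x y).resolve_left h, ?_⟩
    rintro rfl
    exact h (R.ge_refl _)
  · exact fun h h' => h.2 (R.ge_antisymm h.1 h')

theorem LinPref.not_gt {x y : T} : ¬ R.gt x y ↔ R.ge y x := by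
  rw [← R.not_ge, not_not]

theorem LinPref.gt_of_ge_of_gt {x y z : T} (h : R.ge x y) (h' : R.gt y z) : R.gt x z := by
  rw [← R.not_ge] at h' ⊢
  exact fun h'' => h' (R.ge_trans h'' h)

theorem LinPref.gt_trans {x y z : T} (h : R.gt x y) (h' : R.gt y z) : R.gt x z :=
  R.gt_of_ge_of_gt h.1 h'

theorem LinPref.gt_irrefl (x : T) : ¬ R.gt x x := fun h => h.2 rfl

theorem LinPref.gt_asymm {x y : T} (h : R.gt x y) : ¬ R.gt y x :=
  R.not_gt.2 h.1

theorem LinPref.gt_or_gt {x y : T} (h : x ≠ y) : R.gt x y ∨ R.gt y x :=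
  (R.ge_total x y).imp (fun h' => ⟨h', h⟩) fun h' => ⟨h', h.symm⟩

theorem LinPref.exists_best {S : Finset T} (hS : S.Nonempty) : ∃ x ∈ S, ∀ y ∈ S, R.ge x y := by
  induction S using Finset.induction_on with
  | empty => simp at hS
  | insert a S _ ih =>
    rcases S.eq_empty_or_nonempty with rfl | hS'
    · exact ⟨a, by simp, by simpa using R.ge_refl a⟩
    · obtain ⟨x, hx, hxS⟩ := ih hS'
      rcases R.ge_total a x with h | h
      · refine ⟨a, by simp, fun y hy => ?_⟩
        rcases Finset.mem_insert.1 hy with rfl | hy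
        · exact R.ge_refl _
        · exact R.ge_trans h (hxS y hy)
      · refine ⟨x, by simp [hx], fun y hy => ?_⟩
        rcases Finset.mem_insert.1 hy with rfl | hy
        · exact h
        · exact hxS y hy

theorem LinPref.ranking_pairwise_gt (S : Finset T) : (R.ranking S).Pairwise R.gt :=
  ((Finset.pairwise_sort S R.ge).and (Finset.sort_nodup S R.ge)).imp fun h => h

/-- The `k` highest elements of `S`, or all of `S` if it has fewer elements. -/
def LinPref.top (k : ℕ) (S : Finset T) : Finset T := ((R.ranking S).take k).toFinset

theorem LinPref.top_subset (k : ℕ) (S : Finset T) : R.top k S ⊆ S := by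
  intro x hx
  simpa [ranking] using List.mem_of_mem_take (List.mem_toFinset.1 hx)

theorem LinPref.card_top (k : ℕ) (S : Finset T) : (R.top k S).card = min k S.card := by
  rw [top, List.toFinset_card_of_nodup, List.length_take, ranking, Finset.length_sort]
  exact (Finset.sort_nodup S R.ge).sublist (List.take_sublist _ _)

theorem LinPref.gt_of_mem_top {k : ℕ} {S : Finset T} {x y : T} (hx : x ∈ R.top k S) (hy : y ∈ S)
    (hy' : y ∉ R.top k S) : R.gt x y := by
  have h := R.ranking_pairwise_gt S
  rw [← List.take_append_drop k (R.ranking S), List.pairwise_append] at h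
  refine h.2.2 x (List.mem_toFinset.1 hx) y ?_
  have h1 : y ∈ (R.ranking S).take k ++ (R.ranking S).drop k := by
    rw [List.take_append_drop]
    simpa [ranking] using hy
  exact (List.mem_append.1 h1).resolve_left fun h2 => hy' (List.mem_toFinset.2 h2)

/-- Counting the better elements makes top segments of different sets comparable. -/
theorem LinPref.mem_top_iff {k : ℕ} {S : Finset T} {x : T} (hx : x ∈ S) :
    x ∈ R.top k S ↔ (S.filter fun y => R.gt y x).card < k := by
  constructor
  · intro h
    have h1 : insert x (S.filter fun y => R.gt y x) ⊆ R.top k S := by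
      intro y hy
      rcases Finset.mem_insert.1 hy with rfl | hy
      · exact h
      · obtain ⟨hy, hyx⟩ := Finset.mem_filter.1 hy
        by_contra h2
        exact R.gt_asymm hyx (R.gt_of_mem_top h hy h2)
    have h2 := Finset.card_le_card h1
    rw [Finset.card_insert_of_notMem (by simp [R.gt_irrefl]), R.card_top] at h2
    omega
  · intro h
    by_contra h1
    have h2 : R.top k S ⊆ S.filter fun y => R.gt y x := fun y hy =>
      Finset.mem_filter.2 ⟨R.top_subset _ _ hy, R.gt_of_mem_top hy hx h1⟩
    have h3 := Finset.card_le_card h2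
    have h4 : (R.top k S).card < S.card :=
      Finset.card_lt_card ⟨R.top_subset _ _, fun h5 => h1 (h5 hx)⟩
    rw [R.card_top] at h3 h4
    omega

theorem LinPref.top_eq {k : ℕ} {S U : Finset T} (hU : U ⊆ S) (hc : U.card = min k S.card)
    (h : ∀ x ∈ U, ∀ y ∈ S, y ∉ U → R.gt x y) : R.top k S = U := by
  refine (Finset.eq_of_subset_of_card_le (fun x hx => ?_) (by rw [hc, R.card_top])).symm
  rw [R.mem_top_iff (hU hx)]
  have h1 : S.filter (fun y => R.gt y x) ⊂ U := by
    refine ⟨fun y hy => ?_, fun h2 => by simpa [R.gt_irrefl] using h2 hx⟩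
    obtain ⟨hy, hyx⟩ := Finset.mem_filter.1 hy
    by_contra h2
    exact R.gt_asymm hyx (h x hx y hy h2)
  have h2 := Finset.card_lt_card h1
  omega

end Order

/-! ### The greedy rule and matroid closure -/

section Greedy

variable {T : Type*} {M : Matroid T} (prio : LinPref T)

theorem mem_closure_of_forall_mem {S S' : Set T} {y : T} (h : ∀ z ∈ S, z ∈ S')
    (hy : y ∈ M.closure S) : y ∈ M.closure S' :=
  M.closure_subset_closure h hy

/-- A contract is passed over only if the current set spans it, and that set consists of contracts
considered earlier, hence of higher priority. The start set is arbitrary for the induction. -/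
theorem foldl_greedyStep_spec (hE : M.E = Set.univ) (l : List T) (hl : l.Pairwise prio.gt)
    (S : Finset T) (hS : M.Indep S) (hSl : ∀ s ∈ S, ∀ x ∈ l, prio.gt s x) :
    S ⊆ l.foldl (greedyStep M) S ∧ M.Indep (l.foldl (greedyStep M) S : Finset T) ∧
      ∀ y ∈ l, y ∉ l.foldl (greedyStep M) S →
        y ∈ M.closure {x | x ∈ l.foldl (greedyStep M) S ∧ prio.gt x y} := by
  induction l generalizing S with
  | nil => simpa using hS
  | cons a l ih =>
    rw [List.foldl_cons]
    rw [List.pairwise_cons] at hl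
    by_cases h : M.Indep (insert a S : Finset T)
    · have h1 : greedyStep M S a = insert a S := if_pos h
      rw [h1]
      obtain ⟨h2, h3, h4⟩ := ih hl.2 (insert a S) h fun s hs x hx => by
        rcases Finset.mem_insert.1 hs with rfl | hs
        · exact hl.1 x hx
        · exact hSl s hs x (List.mem_cons_of_mem _ hx)
      refine ⟨(Finset.subset_insert _ _).trans h2, h3, fun y hy hy' => ?_⟩
      rcases List.mem_cons.1 hy with rfl | hy
      · exact absurd (h2 (Finset.mem_insert_self _ _)) hy'
      · exact h4 y hy hy'
    · have h1 : greedyStep M S a = S := if_neg h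
      rw [h1]
      obtain ⟨h2, h3, h4⟩ := ih hl.2 S hS fun s hs x hx => hSl s hs x (List.mem_cons_of_mem _ hx)
      refine ⟨h2, h3, fun y hy hy' => ?_⟩
      rcases List.mem_cons.1 hy with rfl | hy
      · have h5 : y ∈ M.closure S := by
          by_contra h6
          refine h ?_
          rw [Finset.coe_insert, hS.insert_indep_iff]
          exact Or.inl ⟨by simp [hE], h6⟩
        exact mem_closure_of_forall_mem (fun s hs => ⟨h2 hs, hSl s hs y List.mem_cons_self⟩) h5
      · exact h4 y hy hy'

theorem greedy_indep (hE : M.E = Set.univ) (Y : Finset T) :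
    M.Indep (greedy M prio Y : Finset T) :=
  (foldl_greedyStep_spec prio hE _ (prio.ranking_pairwise_gt Y) ∅ (by simp) (by simp)).2.1

theorem mem_closure_greedy_gt (hE : M.E = Set.univ) {Y : Finset T} {y : T} (hy : y ∈ Y)
    (hy' : y ∉ greedy M prio Y) : y ∈ M.closure {x | x ∈ greedy M prio Y ∧ prio.gt x y} :=
  (foldl_greedyStep_spec prio hE _ (prio.ranking_pairwise_gt Y) ∅ (by simp) (by simp)).2.2 y
    (by simpa [LinPref.ranking] using hy) hy'

theorem subset_closure_greedy (hE : M.E = Set.univ) (Y : Finset T) :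
    (Y : Set T) ⊆ M.closure (greedy M prio Y) := by
  intro y hy
  by_cases h : y ∈ greedy M prio Y
  · exact M.subset_closure _ (by simp [hE]) h
  · exact mem_closure_of_forall_mem (fun x hx => hx.1) (mem_closure_greedy_gt prio hE hy h)

/-- Each passed-over contract above `y` is spanned by greedy contracts above it, so the greedy
contracts above `y` span everything in `Y` above `y`. If they spanned a chosen `y` too, the greedy
set would be dependent. The criterion refers only to `Y`, which makes it monotone. -/
theorem mem_greedy_iff (hE : M.E = Set.univ) {Y : Finset T} {y : T} (hy : y ∈ Y) :
    y ∈ greedy M prio Y ↔ y ∉ M.closure {x | x ∈ Y ∧ prio.gt x y} := by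
  constructor
  · intro h h1
    have h2 : M.closure {x | x ∈ Y ∧ prio.gt x y} ⊆
        M.closure {x | x ∈ greedy M prio Y ∧ prio.gt x y} := by
      refine M.closure_subset_closure_of_subset_closure fun x hx => ?_
      by_cases h3 : x ∈ greedy M prio Y
      · exact M.subset_closure _ (by simp [hE]) ⟨h3, hx.2⟩
      · exact mem_closure_of_forall_mem (fun z hz => ⟨hz.1, prio.gt_trans hz.2 hx.2⟩)
          (mem_closure_greedy_gt prio hE hx.1 h3)
    refine (greedy_indep prio hE Y).notMem_closure_sdiff_of_mem (Finset.mem_coe.2 h) ?_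
    exact mem_closure_of_forall_mem (fun x hx => ⟨hx.1, fun h3 => hx.2.2 h3⟩) (h2 h1)
  · intro h
    by_contra h1
    exact h (mem_closure_of_forall_mem (fun x hx => ⟨greedy_subset M prio Y hx.1, hx.2⟩)
      (mem_closure_greedy_gt prio hE hy h1))

/-- The greedy set is independent and spans `Y`. In particular the rank is finite. -/
theorem eRk_eq_card_greedy (hE : M.E = Set.univ) (Y : Finset T) :
    M.eRk Y = (greedy M prio Y).card := by
  rw [← Set.encard_coe_eq_coe_finsetCard, ← (greedy_indep prio hE Y).eRk_eq_encard]
  refine le_antisymm ?_ (M.eRk_mono (Finset.coe_subset.2 (greedy_subset M prio Y)))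
  rw [← M.eRk_closure_eq (greedy M prio Y : Set T)]
  exact M.eRk_mono (subset_closure_greedy prio hE Y)

theorem card_greedy_mono (hE : M.E = Set.univ) {Y Y' : Finset T} (h : Y ⊆ Y') :
    (greedy M prio Y).card ≤ (greedy M prio Y').card := by
  have h1 := M.eRk_mono (Finset.coe_subset.2 h)
  rw [eRk_eq_card_greedy prio hE, eRk_eq_card_greedy prio hE] at h1
  exact_mod_cast h1

theorem mem_greedy_of_subset (hE : M.E = Set.univ) {Y Y' : Finset T} (h : Y ⊆ Y') {x : T}
    (hx : x ∈ Y) (hx' : x ∈ greedy M prio Y') : x ∈ greedy M prio Y := by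
  rw [mem_greedy_iff prio hE (h hx)] at hx'
  rw [mem_greedy_iff prio hE hx]
  exact fun h1 => hx' (mem_closure_of_forall_mem (fun z hz => ⟨h hz.1, hz.2⟩) h1)

/-- If `y` is spanned by `X`, but not by the elements of `X` above `y`, then it can replace an
element of `X` below `y` without a loss of rank. -/
theorem exists_exchange (hE : M.E = Set.univ) {X : Finset T} {y : T} (hyX : y ∉ X)
    (hy : y ∈ M.closure X) (hy' : y ∉ M.closure {x | x ∈ X ∧ prio.gt x y}) :
    ∃ x ∈ X, prio.gt y x ∧ M.eRk X ≤ M.eRk (insert y (X.erase x) : Finset T) := by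
  -- Take `S` maximal among the subsets of `X` that contain all elements above `y` and do not span
  -- `y`. Any `x` in `X` outside `S` lies below `y`, and adding it makes `y` spanned, so closure
  -- exchange puts `x` in the span of `S` and `y`.
  let F : Finset (Finset T) := X.powerset.filter fun S =>
    (∀ x ∈ X, prio.gt x y → x ∈ S) ∧ y ∉ M.closure (S : Set T)
  have hF : F.Nonempty := by
    refine ⟨X.filter fun x => prio.gt x y, ?_⟩
    simp only [F, Finset.mem_filter, Finset.mem_powerset, Finset.filter_subset, true_and,
      Finset.coe_filter]
    exact ⟨fun x hx h => ⟨hx, h⟩, hy'⟩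
  obtain ⟨S, hS⟩ := F.exists_maximal hF
  have hS1 := hS.1
  simp only [F, Finset.mem_filter, Finset.mem_powerset] at hS1
  obtain ⟨hSX, hSy, hSc⟩ := hS1
  obtain ⟨x, hx, hxS⟩ : ∃ x ∈ X, x ∉ S := by
    by_contra! h
    exact hSc (Finset.Subset.antisymm hSX h ▸ hy)
  have hyx : prio.gt y x := by
    refine (prio.gt_or_gt fun h => hyX ?_).resolve_right fun h => hxS (hSy x hx h)
    rwa [h]
  have h1 : y ∈ M.closure (insert x S : Set T) := by
    by_contra h2
    have h3 : insert x S ∈ F := by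
      simp only [F, Finset.mem_filter, Finset.mem_powerset, Finset.coe_insert]
      exact ⟨Finset.insert_subset hx hSX, fun z hz h => Finset.mem_insert_of_mem (hSy z hz h), h2⟩
    exact hxS (hS.2 h3 (Finset.subset_insert _ _) (Finset.mem_insert_self _ _))
  have h2 := (M.closure_exchange ⟨h1, hSc⟩).1
  refine ⟨x, hx, hyx, ?_⟩
  rw [← M.eRk_closure_eq (insert y (X.erase x) : Finset T)]
  refine M.eRk_mono fun z hz => ?_
  by_cases h3 : z = x
  · rw [h3]
    refine M.closure_subset_closure ?_ h2
    rw [Finset.coe_insert]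
    refine Set.insert_subset_insert fun w hw => ?_
    exact Finset.mem_erase.2 ⟨fun h => hxS (h ▸ hw), hSX hw⟩
  · exact M.subset_closure _ (by simp [hE])
      (Finset.mem_insert_of_mem (Finset.mem_erase.2 ⟨h3, hz⟩))

end Greedy

/-! ### The non-wasteful matroid choice rule -/

section MatroidChoice

variable {T : Type*} {M : Matroid T} (prio : LinPref T) {q : ℕ}

theorem matroidChoose_eq (Y : Finset T) : matroidChoose M prio q Y =
    greedy M prio Y ∪ prio.top (q - (greedy M prio Y).card) (Y \ greedy M prio Y) := rfl

theorem matroidChoose_subset (Y : Finset T) : matroidChoose M prio q Y ⊆ Y :=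
  (matroidChoice M prio q).choose_subset Y

/-- The capacity bound on independent sets keeps `q - (greedy M prio Y).card` from truncating. -/
theorem card_matroidChoose (hE : M.E = Set.univ)
    (hq : ∀ Y : Finset T, M.Indep Y → Y.card ≤ q) (Y : Finset T) :
    (matroidChoose M prio q Y).card = min q Y.card := by
  have h1 := hq _ (greedy_indep prio hE Y)
  have h2 := Finset.card_sdiff_add_card_eq_card (greedy_subset M prio Y)
  rw [matroidChoose_eq, Finset.card_union_of_disjoint, prio.card_top]
  · omega
  · exact Finset.disjoint_of_subset_right (prio.top_subset _ _) Finset.disjoint_sdiff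

/-- The substitutes condition. Enlarging the choice problem does not shrink the greedy set, so no
more seats remain for the second step, while contracts passed over by the greedy rule remain passed
over, so the competition for those seats does not weaken. -/
theorem mem_matroidChoose_of_subset (hE : M.E = Set.univ)
    {Y Y' : Finset T} (h : Y ⊆ Y') {x : T} (hx : x ∈ Y)
    (hx' : x ∈ matroidChoose M prio q Y') : x ∈ matroidChoose M prio q Y := by
  rw [matroidChoose_eq, Finset.mem_union] at hx' ⊢
  by_cases h1 : x ∈ greedy M prio Y
  · exact Or.inl h1
  have h2 : x ∉ greedy M prio Y' := fun h2 => h1 (mem_greedy_of_subset prio hE h hx h2)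
  replace hx' := hx'.resolve_left h2
  right
  rw [prio.mem_top_iff (Finset.mem_sdiff.2 ⟨h hx, h2⟩)] at hx'
  rw [prio.mem_top_iff (Finset.mem_sdiff.2 ⟨hx, h1⟩)]
  have h3 := card_greedy_mono prio hE h
  have h4 : ((Y \ greedy M prio Y).filter fun y => prio.gt y x).card ≤
      ((Y' \ greedy M prio Y').filter fun y => prio.gt y x).card := by
    refine Finset.card_le_card (Finset.filter_subset_filter _ fun y hy => ?_)
    rw [Finset.mem_sdiff] at hy ⊢
    exact ⟨h hy.1, fun h5 => hy.2 (mem_greedy_of_subset prio hE h hy.1 h5)⟩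
  omega

theorem eRk_matroidChoose (hE : M.E = Set.univ) (Y : Finset T) :
    M.eRk (matroidChoose M prio q Y) = M.eRk Y := by
  refine le_antisymm (M.eRk_mono (Finset.coe_subset.2 (matroidChoose_subset prio Y))) ?_
  rw [← M.eRk_closure_eq (matroidChoose M prio q Y : Set T)]
  refine M.eRk_mono ((subset_closure_greedy prio hE Y).trans (M.closure_subset_closure ?_))
  exact Finset.coe_subset.2 Finset.subset_union_left

/-- Second-step choices outrank the rejected `y`, so `x`, being below `y`, is greedy. Then `y` and
all second-step choices lie above `x`, and the greedy contracts other than `x` span them; the rank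
drops below the size of the greedy set. -/
theorem eRk_exchange_matroidChoose_lt (hE : M.E = Set.univ) {Y : Finset T} {x y : T}
    (hx : x ∈ matroidChoose M prio q Y) (hy : y ∈ Y) (hy' : y ∉ matroidChoose M prio q Y)
    (hyx : prio.gt y x) :
    M.eRk (insert y ((matroidChoose M prio q Y).erase x) : Finset T) <
      M.eRk (matroidChoose M prio q Y) := by
  rw [eRk_matroidChoose prio hE Y, eRk_eq_card_greedy prio hE Y]
  have hyG : y ∉ greedy M prio Y := fun h => hy' (Finset.mem_union_left _ h)
  have hyT : y ∉ prio.top (q - (greedy M prio Y).card) (Y \ greedy M prio Y) :=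
    fun h => hy' (Finset.mem_union_right _ h)
  have hbelow : ∀ z ∈ prio.top (q - (greedy M prio Y).card) (Y \ greedy M prio Y),
      prio.gt z y := fun z hz => prio.gt_of_mem_top hz (Finset.mem_sdiff.2 ⟨hy, hyG⟩) hyT
  have hxG : x ∈ greedy M prio Y := (Finset.mem_union.1 hx).resolve_right
    fun h => prio.gt_asymm hyx (hbelow x h)
  have key : ∀ z ∈ Y, z ∉ greedy M prio Y → prio.ge z y →
      z ∈ M.closure ((greedy M prio Y).erase x) := by
    intro z hz hzG hzy
    refine mem_closure_of_forall_mem (fun w hw => ?_) (mem_closure_greedy_gt prio hE hz hzG)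
    refine Finset.mem_erase.2 ⟨?_, hw.1⟩
    rintro rfl
    exact prio.gt_irrefl _ (prio.gt_trans hw.2 (prio.gt_of_ge_of_gt hzy hyx))
  have h1 : M.eRk (insert y ((matroidChoose M prio q Y).erase x) : Finset T) ≤
      ((greedy M prio Y).erase x).card := by
    rw [← Set.encard_coe_eq_coe_finsetCard]
    refine le_trans ?_ (M.eRk_le_encard _)
    rw [← M.eRk_closure_eq ((greedy M prio Y).erase x : Set T)]
    refine M.eRk_mono fun z hz => ?_
    rcases Finset.mem_insert.1 hz with rfl | hz
    · exact key z hy hyG (prio.ge_refl z)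
    · obtain ⟨hzx, hz⟩ := Finset.mem_erase.1 hz
      by_cases hzG : z ∈ greedy M prio Y
      · exact M.subset_closure _ (by simp [hE]) (Finset.mem_erase.2 ⟨hzx, hzG⟩)
      · exact key z (matroidChoose_subset prio Y hz) hzG
          (hbelow z ((Finset.mem_union.1 hz).resolve_left hzG)).1
  refine h1.trans_lt ?_
  exact_mod_cast Finset.card_erase_lt_of_mem hxG

/-- The choices of the non-wasteful matroid choice rule are characterized by non-wastefulness,
the matroidal objective and the absence of justified envy under rank. -/
theorem matroidChoose_eq_iff [dec : DecidableEq T] (hE : M.E = Set.univ)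
    (hq : ∀ Y : Finset T, M.Indep Y → Y.card ≤ q) {X Y : Finset T} (hXY : X ⊆ Y) :
    matroidChoose M prio q Y = X ↔
      (X.card ≤ q ∧ ∀ y ∈ Y, y ∉ X → X.card = q) ∧
      (∀ x ∈ X, ∀ y ∈ Y, y ∉ X → prio.gt y x →
        M.eRk (insert y (X.erase x) : Finset T) < M.eRk X) ∧
      ∀ y ∈ Y, y ∉ X → M.eRk (insert y X : Finset T) = M.eRk X := by
  -- An arbitrary instance in the statement lets the lemma apply whichever decidable equality the
  -- contract subtypes carry.
  obtain rfl : dec = Classical.decEq T := Subsingleton.elim _ _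
  constructor
  · rintro rfl
    have hc := card_matroidChoose prio hE hq Y
    refine ⟨⟨by omega, fun y hy hy' => ?_⟩, fun x hx y hy hy' hyx =>
      eRk_exchange_matroidChoose_lt prio hE hx hy hy' hyx, fun y hy hy' => ?_⟩
    · have h1 := Finset.card_lt_card
        (Finset.ssubset_iff_subset_ne.2 ⟨hXY, fun h => hy' (by rwa [h])⟩)
      omega
    · refine le_antisymm ?_ (M.eRk_mono (Finset.coe_subset.2 (Finset.subset_insert _ _)))
      rw [eRk_matroidChoose prio hE Y]
      exact M.eRk_mono (Finset.coe_subset.2 (Finset.insert_subset hy hXY))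
  · rintro ⟨⟨hle, hcard⟩, hnje, hmo⟩
    have hspan : ∀ y ∈ Y, y ∈ M.closure X := by
      intro y hy
      by_cases hyX : y ∈ X
      · exact M.subset_closure _ (by simp [hE]) hyX
      · by_contra h
        have h1 := M.eRk_insert_eq_add_one (e := y) (X := X) ⟨by simp [hE], h⟩
        -- The rank is a natural number, so it cannot equal its own successor.
        rw [← Finset.coe_insert, hmo y hy hyX, eRk_eq_card_greedy prio hE] at h1
        norm_cast at h1
        omega
    -- A greedy `y` outside `X` is spanned by `X` but not by the part of `X` above it, so exchange
    -- gives a swap without loss of rank: justified envy.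
    have hGX : greedy M prio Y ⊆ X := by
      intro y hy
      by_contra hyX
      have hyY := greedy_subset M prio Y hy
      obtain ⟨x, hx, hyx, hr⟩ := exists_exchange prio hE hyX (hspan y hyY) fun h =>
        (mem_greedy_iff prio hE hyY).1 hy (mem_closure_of_forall_mem
          (fun z hz => ⟨hXY hz.1, hz.2⟩) h)
      exact (hnje x hx y hyY hyX hyx).not_ge hr
    have hrX : M.eRk X ≤ M.eRk (greedy M prio Y : Set T) := by
      rw [← M.eRk_closure_eq (greedy M prio Y : Set T)]
      exact M.eRk_mono ((Finset.coe_subset.2 hXY).trans (subset_closure_greedy prio hE Y))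
    have hG := hq _ (greedy_indep prio hE Y)
    have h2 := Finset.card_sdiff_add_card_eq_card hGX
    have h3 := Finset.card_sdiff_add_card_eq_card (greedy_subset M prio Y)
    have h4 : X.card = min q Y.card := by
      by_cases h : Y ⊆ X
      · rw [Finset.Subset.antisymm h hXY]
        have h5 := Finset.card_le_card h
        omega
      · obtain ⟨y, hy, hyX⟩ := Finset.not_subset.1 h
        have h5 := hcard y hy hyX
        have h6 := Finset.card_le_card hXY
        omega
    rw [matroidChoose_eq, prio.top_eq (U := X \ greedy M prio Y)
      (Finset.sdiff_subset_sdiff hXY (Finset.Subset.refl _)) (by omega),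
      Finset.union_sdiff_of_subset hGX]
    intro x hx y hy hy'
    obtain ⟨hx, hxG⟩ := Finset.mem_sdiff.1 hx
    obtain ⟨hy, hyG⟩ := Finset.mem_sdiff.1 hy
    have hyX : y ∉ X := fun h => hy' (Finset.mem_sdiff.2 ⟨h, hyG⟩)
    -- If `y` were above `x`, swapping them would keep the whole greedy set and hence the rank,
    -- contrary to the absence of justified envy.
    refine (prio.gt_or_gt fun h => hyX (by rwa [← h])).resolve_right fun hyx => ?_
    refine (hnje x hx y hy hyX hyx).not_ge (hrX.trans (M.eRk_mono fun z hz => ?_))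
    exact Finset.mem_insert_of_mem (Finset.mem_erase.2 ⟨fun h => hxG (h ▸ hz), hGX hz⟩)

end MatroidChoice

/-! ### Matchings and assignments -/

section Assignment

variable {A X : Type*} {agent : X → A}

theorem mem_part {B : Type*} {f : X → B} {Z : Finset X} {b : B} {x : ContractsOf f b} :
    x ∈ part f Z b ↔ x.1 ∈ Z := by
  simp [part]

theorem Matching.assignment_eq_some_iff (Z : Matching agent) {a : A} {x : ContractsOf agent a} :
    Z.assignment a = some x ↔ x.1 ∈ Z.contracts := by
  have huniq : ∀ y : ContractsOf agent a, x.1 ∈ Z.contracts → y.1 ∈ Z.contracts → y = x :=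
    fun y hx hy => Subtype.ext
      ((part_card_le_one_iff _ _).1 (Z.card_le_one a) _ hy _ hx y.2 x.2)
  unfold Matching.assignment
  split_ifs with h
  · rw [Option.some_inj]
    constructor
    · intro h1
      rw [← h1]
      exact h.choose_spec
    · exact fun hx => huniq _ hx h.choose_spec
  · simp only [false_iff]
    exact fun hx => h ⟨x, hx⟩

theorem Matching.assignment_eq_none_iff (Z : Matching agent) {a : A} :
    Z.assignment a = none ↔ ∀ x : ContractsOf agent a, x.1 ∉ Z.contracts := by
  rw [Option.eq_none_iff_forall_ne_some]
  exact forall_congr' fun x => not_congr Z.assignment_eq_some_iff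

theorem Matching.ext_assignment {Z Z' : Matching agent}
    (h : ∀ a, Z.assignment a = Z'.assignment a) : Z = Z' := by
  have h1 : Z.contracts = Z'.contracts := by
    ext x
    have h2 := Z.assignment_eq_some_iff (x := (⟨x, rfl⟩ : ContractsOf agent (agent x)))
    have h3 := Z'.assignment_eq_some_iff (x := (⟨x, rfl⟩ : ContractsOf agent (agent x)))
    rw [← h2, ← h3, h]
  cases Z
  cases Z'
  simpa using h1

theorem Matching.card_image_agent (Z : Matching agent) :
    (Z.contracts.image agent).card = Z.contracts.card :=
  Finset.card_image_of_injOn fun x hx y hy h =>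
    (part_card_le_one_iff _ _).1 (Z.card_le_one (agent y)) x hx y hy h rfl

theorem Matching.mem_image_agent (Z : Matching agent) {a : A} :
    a ∈ Z.contracts.image agent ↔ Z.assignment a ≠ none := by
  rw [Ne, Z.assignment_eq_none_iff, Finset.mem_image]
  push Not
  exact ⟨fun ⟨x, hx, h⟩ => ⟨⟨x, h⟩, hx⟩, fun ⟨x, hx⟩ => ⟨x.1, hx, x.2⟩⟩

end Assignment

/-! ### Substitutes, aggregate demand and stability -/

section Stability

variable {A I X : Type*} {agent : X → A} {inst : X → I}

/-- A profile of choice rules satisfying the substitutes condition and the law of aggregate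
demand, expressed by the set of contracts accepted by all the institutions. -/
structure SubstitutesLAD (C : (i : I) → ChoiceRule (ContractsOf inst i)) : Prop where
  subst : ∀ {Y Y' : Finset X}, Y ⊆ Y' → ∀ x ∈ Y, x ∈ accepted C Y' → x ∈ accepted C Y
  card_mono : ∀ {Y Y' : Finset X}, Y ⊆ Y' → (accepted C Y).card ≤ (accepted C Y').card

theorem accepted_subset (C : (i : I) → ChoiceRule (ContractsOf inst i)) (Y : Finset X) :
    accepted C Y ⊆ Y :=
  Finset.filter_subset _ _

variable {C : (i : I) → ChoiceRule (ContractsOf inst i)}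

/-- Irrelevance of rejected contracts: substitutes keep every accepted contract accepted, and
aggregate demand leaves no room for another. -/
theorem SubstitutesLAD.accepted_eq (hC : SubstitutesLAD C) {Y Y' : Finset X}
    (h : accepted C Y' ⊆ Y) (h' : Y ⊆ Y') : accepted C Y = accepted C Y' :=
  (Finset.eq_of_subset_of_card_le (fun x hx => hC.subst h' x (h hx) hx) (hC.card_mono h')).symm

theorem SubstitutesLAD.accepted_accepted_union (hC : SubstitutesLAD C) (Y Z : Finset X) :
    accepted C (accepted C Y ∪ Z) = accepted C (Y ∪ Z) := by
  refine hC.accepted_eq (fun x hx => ?_)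
    (Finset.union_subset_union (accepted_subset C Y) (Finset.Subset.refl Z))
  rcases Finset.mem_union.1 (accepted_subset C _ hx) with h | h
  · exact Finset.mem_union_left _ (hC.subst Finset.subset_union_left x h hx)
  · exact Finset.mem_union_right _ h

variable [Fintype X]

/-- The contracts that their agents weakly prefer to their assignments in `Z`. -/
def weakUpper (R : Problem agent) (Z : Matching agent) : Finset X :=
  Finset.univ.filter fun x => (R (agent x)).ge (some ⟨x, rfl⟩) (Z.assignment (agent x))

theorem mem_weakUpper {R : Problem agent} {Z : Matching agent} {a : A} (x : ContractsOf agent a) :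
    x.1 ∈ weakUpper R Z ↔ (R a).ge (some x) (Z.assignment a) := by
  obtain ⟨x, rfl⟩ := x
  simp [weakUpper]

theorem contracts_subset_weakUpper (R : Problem agent) (Z : Matching agent) :
    Z.contracts ⊆ weakUpper R Z := by
  intro x hx
  rw [mem_weakUpper (⟨x, rfl⟩ : ContractsOf agent (agent x)),
    (Z.assignment_eq_some_iff (x := ⟨x, rfl⟩)).2 hx]
  exact (R _).ge_refl _

theorem weakUpper_subset {R R' : Problem agent} {Z Z' : Matching agent}
    (h : ∀ a (x : ContractsOf agent a), (R a).ge (some x) (Z.assignment a) →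
      (R' a).ge (some x) (Z'.assignment a)) : weakUpper R Z ⊆ weakUpper R' Z' := by
  intro x hx
  rw [mem_weakUpper (⟨x, rfl⟩ : ContractsOf agent (agent x))] at hx ⊢
  exact h _ _ hx

/-- Stability of a matching: individual rationality, and the institutions choose their contracts
when all the contracts that are weakly preferred to the matching are available. -/
structure Stable (C : (i : I) → ChoiceRule (ContractsOf inst i)) (R : Problem agent)
    (Z : Matching agent) : Prop where
  individuallyRational : IndividuallyRational R Z
  accepted_eq : accepted C (weakUpper R Z) = Z.contracts

/-- The new report adds no contract to those weakly preferred to `Z` and keeps the contracts of `Z`;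
only rejected contracts disappear. -/
theorem Stable.update (hC : SubstitutesLAD C) {R : Problem agent} {Z : Matching agent}
    (hZ : Stable C R Z) {a : A} {P : LinPref (Option (ContractsOf agent a))}
    (h1 : P.ge (Z.assignment a) none)
    (h2 : ∀ x, P.ge (some x) (Z.assignment a) → (R a).ge (some x) (Z.assignment a)) :
    Stable C (Function.update R a P) Z where
  individuallyRational b := by
    by_cases h : b = a
    · subst h
      simpa using h1
    · rw [Function.update_of_ne h]
      exact hZ.individuallyRational b
  accepted_eq := by
    rw [hC.accepted_eq (Y' := weakUpper R Z), hZ.accepted_eq]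
    · rw [hZ.accepted_eq]
      exact contracts_subset_weakUpper _ _
    · refine weakUpper_subset fun b x hx => ?_
      by_cases h : b = a
      · subst h
        exact h2 x (by simpa using hx)
      · rwa [Function.update_of_ne h] at hx

end Stability

/-! ### Reports with a prescribed acceptable set -/

section Restrict

variable {T : Type*}

/-- The class of an outcome in the order that makes exactly the elements of `K` acceptable. -/
def restrictClass (K : Set T) : Option T → ℕ
  | none => 1
  | some x => if x ∈ K then 0 else 2

/-- The order obtained from `R` by making exactly the elements of `K` acceptable. -/
def LinPref.restrict (R : LinPref (Option T)) (K : Set T) : LinPref (Option T) where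
  ge u v := restrictClass K u < restrictClass K v ∨
    restrictClass K u = restrictClass K v ∧ R.ge u v
  linear :=
    { refl := fun u => Or.inr ⟨rfl, R.ge_refl u⟩
      trans := fun u v w h h' => by
        rcases h with h | ⟨h, h1⟩ <;> rcases h' with h' | ⟨h', h2⟩
        · exact Or.inl (h.trans h')
        · exact Or.inl (h'.symm ▸ h)
        · exact Or.inl (h ▸ h')
        · exact Or.inr ⟨h.trans h', R.ge_trans h1 h2⟩
      antisymm := fun u v h h' => by
        rcases h with h | ⟨h, h1⟩ <;> rcases h' with h' | ⟨h', h2⟩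
        · omega
        · omega
        · omega
        · exact R.ge_antisymm h1 h2
      total := fun u v => by
        rcases lt_trichotomy (restrictClass K u) (restrictClass K v) with h | h | h
        · exact Or.inl (Or.inl h)
        · exact (R.ge_total u v).imp (fun h' => Or.inr ⟨h, h'⟩) fun h' => Or.inr ⟨h.symm, h'⟩
        · exact Or.inr (Or.inl h) }

variable (R : LinPref (Option T)) {K : Set T}

theorem LinPref.restrict_ge_none {x : T} : (R.restrict K).ge (some x) none ↔ x ∈ K := by
  by_cases h : x ∈ K <;> simp [LinPref.restrict, restrictClass, h]

theorem LinPref.restrict_ge_of_mem {x y : T} (hx : x ∈ K) :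
    (R.restrict K).ge (some y) (some x) ↔ y ∈ K ∧ R.ge (some y) (some x) := by
  by_cases h : y ∈ K <;> simp [LinPref.restrict, restrictClass, h, hx]

end Restrict

/-! ### Deferred acceptance: stability, optimality, strategy-proofness, uniqueness -/

section DeferredAcceptance

variable {A I X : Type*} [Fintype X] {agent : X → A} {inst : X → I}
  {C : (i : I) → ChoiceRule (ContractsOf inst i)} {R : Problem agent}

theorem mem_newProposals {s : DAState X} {a : A} (x : ContractsOf agent a) :
    x.1 ∈ newProposals R s ↔ (∀ y ∈ s.held, agent y ≠ a) ∧ x.1 ∉ s.rejected ∧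
      (R a).ge (some x) none ∧
        ∀ y : ContractsOf agent a, y.1 ∉ s.rejected → (R a).ge (some x) (some y) := by
  obtain ⟨x, rfl⟩ := x
  simp [newProposals]

/-- Properties of the states reached by the deferred-acceptance algorithm. -/
structure DAInvariant (C : (i : I) → ChoiceRule (ContractsOf inst i)) (R : Problem agent)
    (s : DAState X) : Prop where
  disjoint : Disjoint s.held s.rejected
  held_eq : accepted C (s.held ∪ s.rejected) = s.held
  acceptable : ∀ a (x : ContractsOf agent a), x.1 ∈ s.held ∪ s.rejected → (R a).ge (some x) none
  rejected_of_gt : ∀ a (x y : ContractsOf agent a), x.1 ∈ s.held ∪ s.rejected →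
    (R a).gt (some y) (some x) → y.1 ∈ s.rejected
  notMem_of_stable : ∀ Z : Matching agent, Stable C R Z → ∀ z ∈ Z.contracts, z ∉ s.rejected

theorem daStep_held_union_rejected (C : (i : I) → ChoiceRule (ContractsOf inst i))
    (R : Problem agent) (s : DAState X) :
    (daStep C R s).held ∪ (daStep C R s).rejected = considered R s ∪ s.rejected := by
  have h := accepted_subset C (considered R s)
  ext x
  have h1 := @h x
  simp only [daStep, Finset.mem_union, Finset.mem_sdiff]
  tauto

/-- The union of held and rejected contracts is the set of all proposals so far. Path independence
makes the current choice a choice from that whole set. -/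
theorem DAInvariant.daStep (hC : SubstitutesLAD C) {s : DAState X} (hs : DAInvariant C R s) :
    DAInvariant C R (daStep C R s) := by
  have hdisj : Disjoint (considered R s) s.rejected := by
    rw [considered, Finset.disjoint_union_left]
    refine ⟨hs.disjoint, Finset.disjoint_left.2 fun x hx => ?_⟩
    exact ((mem_newProposals (⟨x, rfl⟩ : ContractsOf agent (agent x))).1 hx).2.1
  have hup : ∀ a (x y : ContractsOf agent a), x.1 ∈ considered R s ∪ s.rejected →
      (R a).gt (some y) (some x) → y.1 ∈ s.rejected := by
    intro a x y hx hyx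
    simp only [considered, Finset.mem_union] at hx
    rcases hx with (hx | hx) | hx
    · exact hs.rejected_of_gt a x y (Finset.mem_union_left _ hx) hyx
    · by_contra h
      exact (R a).not_ge.2 hyx (((mem_newProposals x).1 hx).2.2.2 y h)
    · exact hs.rejected_of_gt a x y (Finset.mem_union_right _ hx) hyx
  have hacc : ∀ a (x : ContractsOf agent a), x.1 ∈ considered R s ∪ s.rejected →
      (R a).ge (some x) none := by
    intro a x hx
    simp only [considered, Finset.mem_union] at hx
    rcases hx with (hx | hx) | hx
    · exact hs.acceptable a x (Finset.mem_union_left _ hx)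
    · exact ((mem_newProposals x).1 hx).2.2.1
    · exact hs.acceptable a x (Finset.mem_union_right _ hx)
  have hheld : accepted C (considered R s ∪ s.rejected) = accepted C (considered R s) := by
    have h := hC.accepted_accepted_union (s.held ∪ s.rejected) (newProposals R s)
    rw [hs.held_eq] at h
    rw [considered, h, Finset.union_right_comm]
  refine ⟨?_, ?_, ?_, ?_, ?_⟩
  · refine Finset.disjoint_left.2 fun x hx hx' => ?_
    rcases Finset.mem_union.1 hx' with h | h
    · exact Finset.disjoint_left.1 hdisj (accepted_subset C _ hx) h
    · exact (Finset.mem_sdiff.1 h).2 hx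
  · rw [daStep_held_union_rejected]
    exact hheld
  · rw [daStep_held_union_rejected]
    exact hacc
  · rw [daStep_held_union_rejected]
    exact fun a x y hx hyx => Finset.mem_union_left _ (hup a x y hx hyx)
  · intro Z hZ z hz hz'
    rcases Finset.mem_union.1 hz' with h | h
    · exact hs.notMem_of_stable Z hZ z hz h
    · obtain ⟨hz1, hz2⟩ := Finset.mem_sdiff.1 h
      -- As no contract of `Z` was rejected before, no agent has proposed anything worse than its
      -- assignment in `Z`. By substitutes, a contract of `Z` chosen from the larger set `weakUpper
      -- R Z` cannot be rejected now.
      have hsub : considered R s ∪ s.rejected ⊆ weakUpper R Z := by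
        intro x hx
        rw [mem_weakUpper (⟨x, rfl⟩ : ContractsOf agent (agent x))]
        by_contra h1
        rw [LinPref.not_ge] at h1
        cases h2 : Z.assignment (agent x) with
        | none =>
          rw [h2] at h1
          exact (R _).not_ge.2 h1 (hacc _ _ hx)
        | some y =>
          rw [h2] at h1
          exact hs.notMem_of_stable Z hZ y.1 (Z.assignment_eq_some_iff.1 h2)
            (hup _ ⟨x, rfl⟩ y hx h1)
      refine hz2 ?_
      rw [← hheld]
      refine hC.subst hsub z (Finset.mem_union_left _ hz1) ?_
      rwa [hZ.accepted_eq]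

theorem DAInvariant.initial (C : (i : I) → ChoiceRule (ContractsOf inst i)) (R : Problem agent) :
    DAInvariant C R ⟨∅, ∅⟩ where
  disjoint := by simp
  held_eq := by simp [accepted]
  acceptable := by simp
  rejected_of_gt := by simp
  notMem_of_stable := by simp

/-- Otherwise the agent's best unrejected contract would be acceptable and proposed in this step,
and a step without rejections would hold it. -/
theorem daStep_rejected_of_final {s : DAState X} (hs : DAInvariant C R s)
    (hfin : (daStep C R s).rejected = s.rejected) {a : A}
    (ha : ∀ y ∈ (daStep C R s).held, agent y ≠ a) {x : ContractsOf agent a}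
    (hx : (R a).ge (some x) none) : x.1 ∈ (daStep C R s).rejected := by
  have hcons : ∀ y ∈ considered R s, y ∉ s.rejected → agent y ≠ a := by
    intro y hy hy'
    refine ha y ?_
    by_contra h
    refine hy' ?_
    rw [← hfin]
    exact Finset.mem_union_right _ (Finset.mem_sdiff.2 ⟨hy, h⟩)
  rw [hfin]
  by_contra hxr
  obtain ⟨b, hb, hbest⟩ := (R a).exists_best
    (S := (Finset.univ.filter fun y : ContractsOf agent a => y.1 ∉ s.rejected).image some)
    ⟨some x, Finset.mem_image_of_mem _ (by simpa using hxr)⟩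
  obtain ⟨b, hbS, rfl⟩ := Finset.mem_image.1 hb
  have hb' : b.1 ∉ s.rejected := (Finset.mem_filter.1 hbS).2
  have hbest' : ∀ y : ContractsOf agent a, y.1 ∉ s.rejected → (R a).ge (some b) (some y) :=
    fun y hy => hbest _ (Finset.mem_image_of_mem _ (by simpa using hy))
  refine hcons b.1 (Finset.mem_union_right _ ((mem_newProposals b).2
    ⟨fun y hy => ?_, hb', (R a).ge_trans (hbest' x hxr) hx, hbest'⟩)) hb' b.2
  exact hcons y (Finset.mem_union_left _ hy) (Finset.disjoint_left.1 hs.disjoint hy)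

theorem exists_daRun_eq (hC : SubstitutesLAD C) (s : DAState X) (hs : DAInvariant C R s) :
    ∃ t : DAState X, DAInvariant C R t ∧ daRun C R s = t.held ∧
      ∀ a, (∀ y ∈ t.held, agent y ≠ a) → ∀ x : ContractsOf agent a,
        (R a).ge (some x) none → x.1 ∈ t.rejected := by
  induction s using daRun.induct C R with
  | case1 s h =>
    refine ⟨daStep C R s, hs.daStep hC, by rw [daRun, if_pos h], fun a ha x hx => ?_⟩
    exact daStep_rejected_of_final hs h ha hx
  | case2 s h ih =>
    rw [daRun, if_neg h]
    exact ih (hs.daStep hC)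

theorem exists_daRule_eq (hC : SubstitutesLAD C) (R : Problem agent) :
    ∃ t : DAState X, DAInvariant C R t ∧ (daRule C R).contracts = t.held ∧
      ∀ a, (daRule C R).assignment a = none → ∀ x : ContractsOf agent a,
        (R a).ge (some x) none → x.1 ∈ t.rejected := by
  obtain ⟨t, ht, hheld, hfinal⟩ := exists_daRun_eq hC _ (DAInvariant.initial C R)
  refine ⟨t, ht, hheld, fun a ha => hfinal a fun y hy hya => ?_⟩
  rw [Matching.assignment_eq_none_iff] at ha
  refine ha ⟨y, hya⟩ ?_
  rw [← hheld] at hy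
  exact hy

/-- The deferred-acceptance outcome is stable. -/
theorem daRule_stable (hC : SubstitutesLAD C) (R : Problem agent) : Stable C R (daRule C R) := by
  obtain ⟨t, ht, hheld, hfinal⟩ := exists_daRule_eq hC R
  refine ⟨fun a => ?_, ?_⟩
  · cases h : (daRule C R).assignment a with
    | none => exact (R a).ge_refl _
    | some x =>
      rw [Matching.assignment_eq_some_iff, hheld] at h
      exact ht.acceptable a x (Finset.mem_union_left _ h)
  -- Every contract weakly preferred to the outcome has been proposed, so the institutions have
  -- already chosen from a superset.
  · have hsub : weakUpper R (daRule C R) ⊆ t.held ∪ t.rejected := by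
      intro x hx
      rw [mem_weakUpper (⟨x, rfl⟩ : ContractsOf agent (agent x))] at hx
      rw [Finset.mem_union]
      cases h : (daRule C R).assignment (agent x) with
      | none =>
        rw [h] at hx
        exact Or.inr (hfinal _ h _ hx)
      | some y =>
        rw [h] at hx
        rw [Matching.assignment_eq_some_iff, hheld] at h
        by_cases hxy : (⟨x, rfl⟩ : ContractsOf agent (agent x)) = y
        · rw [← hxy] at h
          exact Or.inl h
        · exact Or.inr (ht.rejected_of_gt _ y ⟨x, rfl⟩ (Finset.mem_union_left _ h)
            ⟨hx, by simpa using hxy⟩)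
    rw [hC.accepted_eq ?_ hsub, ht.held_eq, hheld]
    rw [ht.held_eq, ← hheld]
    exact contracts_subset_weakUpper _ _

/-- Every agent weakly prefers the deferred-acceptance outcome to every stable matching. -/
theorem daRule_optimal (hC : SubstitutesLAD C) {Z : Matching agent} (hZ : Stable C R Z) (a : A) :
    (R a).ge ((daRule C R).assignment a) (Z.assignment a) := by
  obtain ⟨t, ht, hheld, hfinal⟩ := exists_daRule_eq hC R
  cases hz : Z.assignment a with
  | none => exact (daRule_stable hC R).individuallyRational a
  | some z =>
    have hzr := ht.notMem_of_stable Z hZ z.1 (Z.assignment_eq_some_iff.1 hz)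
    by_contra h
    rw [LinPref.not_ge] at h
    cases hx : (daRule C R).assignment a with
    | none => exact hzr (hfinal a hx z (hz ▸ hZ.individuallyRational a))
    | some x =>
      rw [hx] at h
      rw [Matching.assignment_eq_some_iff, hheld] at hx
      exact hzr (ht.rejected_of_gt a x z (Finset.mem_union_left _ hx) h)

/-- By optimality, every agent matched in `Z` is matched by deferred acceptance, whose outcome
leaves fewer weakly preferred contracts and so, by aggregate demand, has at most as many contracts
as `Z`. Equal counts force equal sets of matched agents. -/
theorem Stable.assignment_eq_none_iff_daRule (hC : SubstitutesLAD C) {Z : Matching agent}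
    (hZ : Stable C R Z) (a : A) :
    Z.assignment a = none ↔ (daRule C R).assignment a = none := by
  have h1 : Z.contracts.image agent ⊆ (daRule C R).contracts.image agent := by
    intro b hb
    rw [Matching.mem_image_agent] at hb ⊢
    intro h
    have h2 := daRule_optimal hC hZ b
    rw [h] at h2
    exact hb ((R b).ge_antisymm (hZ.individuallyRational b) h2)
  have h2 : (daRule C R).contracts.card ≤ Z.contracts.card := by
    rw [← hZ.accepted_eq, ← (daRule_stable hC R).accepted_eq]
    exact hC.card_mono (weakUpper_subset fun b x hx =>
      (R b).ge_trans hx (daRule_optimal hC hZ b))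
  have h3 := Finset.eq_of_subset_of_card_le h1
    (by rwa [Matching.card_image_agent, Matching.card_image_agent])
  rw [← not_iff_not, ← Ne, ← Ne, ← Matching.mem_image_agent, ← Matching.mem_image_agent, h3]

/-- The rural hospitals theorem: the same agents are unmatched in all stable matchings. -/
theorem Stable.assignment_eq_none_iff (hC : SubstitutesLAD C) {Z Z' : Matching agent}
    (hZ : Stable C R Z) (hZ' : Stable C R Z') (a : A) :
    Z.assignment a = none ↔ Z'.assignment a = none :=
  (hZ.assignment_eq_none_iff_daRule hC a).trans (hZ'.assignment_eq_none_iff_daRule hC a).symm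

/-- Suppose a misreport yields `Z` with a better contract `x`. Then `Z` is stable when the agent
accepts only `x`. Let `W` be the outcome when it accepts exactly the contracts at least as good as
`x`. If `W` leaves the agent unmatched, `W` is stable under the `x`-only report too, against the
rural hospitals theorem; otherwise `W` is stable for the true preferences and beats the optimal
outcome. -/
theorem daRule_strategyProof (hC : SubstitutesLAD C) :
    StrategyProof (daRule C : MatchingRule agent) := by
  intro R a R'
  by_contra h
  rw [LinPref.not_ge] at h
  have hZ := daRule_stable hC (Function.update R a R')
  set Z := daRule C (Function.update R a R')
  have hDA := (daRule_stable hC R).individuallyRational a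
  cases hx : Z.assignment a with
  | none =>
    rw [hx] at h
    exact (R a).not_ge.2 h hDA
  | some x =>
    rw [hx] at h
    have hZ1 : Stable C (Function.update R a ((R a).restrict {x})) Z := by
      have := hZ.update hC (a := a) (P := (R a).restrict {x})
        (by rw [hx]; exact (R a).restrict_ge_none.2 rfl) fun y hy => by
          rw [hx, (R a).restrict_ge_of_mem (Set.mem_singleton x)] at hy
          rw [hx, Set.mem_singleton_iff.1 hy.1]
          exact LinPref.ge_refl _ _
      rwa [Function.update_idem] at this
    let K : Set (ContractsOf agent a) := {y | (R a).ge (some y) (some x)}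
    have hxK : x ∈ K := (R a).ge_refl _
    have hW := daRule_stable hC (Function.update R a ((R a).restrict K))
    set W := daRule C (Function.update R a ((R a).restrict K))
    cases hw : W.assignment a with
    | none =>
      have hW1 : Stable C (Function.update R a ((R a).restrict {x})) W := by
        have := hW.update hC (a := a) (P := (R a).restrict {x})
          (by rw [hw]; exact LinPref.ge_refl _ _) fun y hy => by
            rw [hw, (R a).restrict_ge_none, Set.mem_singleton_iff] at hy
            rw [hw, hy, Function.update_self, (R a).restrict_ge_none]
            exact hxK
        rwa [Function.update_idem] at this
      have h1 := (hZ1.assignment_eq_none_iff hC hW1 a).2 hw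
      rw [hx] at h1
      exact Option.some_ne_none _ h1
    | some w =>
      have hwK : w ∈ K := by
        have h1 := hW.individuallyRational a
        rwa [hw, Function.update_self, (R a).restrict_ge_none] at h1
      have hW2 : Stable C R W := by
        have := hW.update hC (a := a) (P := R a)
          (by rw [hw]; exact (R a).ge_trans hwK ((R a).ge_trans h.1 hDA)) fun y hy => by
            rw [hw] at hy ⊢
            rw [Function.update_self, (R a).restrict_ge_of_mem hwK]
            exact ⟨(R a).ge_trans hy hwK, hy⟩
        rwa [Function.update_idem, Function.update_eq_self] at this
      have h1 := daRule_optimal hC hW2 a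
      rw [hw] at h1
      exact (R a).not_ge.2 h ((R a).ge_trans h1 hwK)

/-- Deferred acceptance is the only stable and strategy-proof matching rule. -/
theorem eq_daRule_of_stable_of_strategyProof (hC : SubstitutesLAD C) {φ : MatchingRule agent}
    (hφ : ∀ R, Stable C R (φ R)) (hsp : StrategyProof φ) : φ = daRule C := by
  funext R
  refine Matching.ext_assignment fun a => ?_
  refine (R a).ge_antisymm ?_ (daRule_optimal hC (hφ R) a)
  cases hx : (daRule C R).assignment a with
  | none => exact (hφ R).individuallyRational a
  | some x =>
    -- Truncate just below `x`. The deferred-acceptance outcome stays stable, so `φ` must match the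
    -- agent within `K`, and strategy-proofness carries this bound back to the true report.
    let K : Set (ContractsOf agent a) := {y | (R a).ge (some y) (some x)}
    have hxK : x ∈ K := (R a).ge_refl _
    have hD : Stable C (Function.update R a ((R a).restrict K)) (daRule C R) :=
      (daRule_stable hC R).update hC (by rw [hx]; exact (R a).restrict_ge_none.2 hxK)
        fun y hy => by
          rw [hx] at hy ⊢
          exact ((R a).restrict_ge_of_mem hxK).1 hy |>.2
    have hS := hφ (Function.update R a ((R a).restrict K))
    have hsp' := hsp R a ((R a).restrict K)
    cases hy : (φ (Function.update R a ((R a).restrict K))).assignment a with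
    | none =>
      have h1 := (hS.assignment_eq_none_iff hC hD a).1 hy
      rw [hx] at h1
      exact absurd h1 (Option.some_ne_none _)
    | some y =>
      rw [hy] at hsp'
      have h1 := hS.individuallyRational a
      rw [hy, Function.update_self, (R a).restrict_ge_none] at h1
      exact (R a).ge_trans hsp' h1

end DeferredAcceptance

/-! ### The axioms as stability -/

section Characterization

variable {A I X : Type*} {agent : X → A} {inst : X → I}

theorem mem_accepted (C : (i : I) → ChoiceRule (ContractsOf inst i)) (Y : Finset X) {i : I}
    (x : ContractsOf inst i) : x.1 ∈ accepted C Y ↔ x ∈ (C i).choose (part inst Y i) := by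
  obtain ⟨x, rfl⟩ := x
  simp only [accepted, Finset.mem_filter, and_iff_right_iff_imp]
  exact fun h => mem_part.1 ((C _).choose_subset _ h)

theorem part_accepted (C : (i : I) → ChoiceRule (ContractsOf inst i)) (Y : Finset X) (i : I) :
    part inst (accepted C Y) i = (C i).choose (part inst Y i) := by
  ext x
  rw [mem_part, mem_accepted]

theorem part_mono {Y Y' : Finset X} (h : Y ⊆ Y') (i : I) : part inst Y i ⊆ part inst Y' i :=
  fun _ hx => mem_part.2 (h (mem_part.1 hx))

theorem eq_iff_part_eq {Y Y' : Finset X} :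
    Y = Y' ↔ ∀ i, part inst Y i = part inst Y' i := by
  refine ⟨fun h i => by rw [h], fun h => ?_⟩
  ext x
  have h1 := @mem_part _ _ inst Y _ ⟨x, rfl⟩
  rw [← h1, h, mem_part]

variable [Fintype X]

/-- The sum runs over the institutions that occur in contracts, since `I` may be infinite. -/
theorem card_eq_sum_card_part (Y : Finset X) :
    Y.card = ∑ i ∈ Finset.univ.image inst, (part inst Y i).card := by
  rw [Finset.card_eq_sum_card_fiberwise (f := inst) (t := Finset.univ.image inst)
    fun x _ => by simp]
  exact Finset.sum_congr rfl fun i _ => by rw [part, Finset.card_subtype]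

theorem substitutesLAD_of_forall {C : (i : I) → ChoiceRule (ContractsOf inst i)}
    (h1 : ∀ i, ∀ {Y Y' : Finset (ContractsOf inst i)}, Y ⊆ Y' → ∀ x ∈ Y,
      x ∈ (C i).choose Y' → x ∈ (C i).choose Y)
    (h2 : ∀ i, ∀ {Y Y' : Finset (ContractsOf inst i)}, Y ⊆ Y' →
      ((C i).choose Y).card ≤ ((C i).choose Y').card) : SubstitutesLAD C where
  subst h x hx hx' := by
    rw [mem_accepted C _ (⟨x, rfl⟩ : ContractsOf inst (inst x))] at hx' ⊢
    exact h1 _ (part_mono h _) _ (mem_part.2 hx) hx'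
  card_mono {Y Y'} h := by
    rw [card_eq_sum_card_part (inst := inst) (accepted C Y),
      card_eq_sum_card_part (inst := inst) (accepted C Y')]
    refine Finset.sum_le_sum fun i _ => ?_
    rw [part_accepted, part_accepted]
    exact h2 i (part_mono h i)

/-- This identifies the contracts quantified over in the axioms with those an institution turns down
when offered `weakUpper R Z`. -/
theorem prefers_iff {R : Problem agent} {Z : Matching agent} {x : X} :
    Prefers R Z x ↔ x ∈ weakUpper R Z ∧ x ∉ Z.contracts := by
  rw [mem_weakUpper (⟨x, rfl⟩ : ContractsOf agent (agent x)), Prefers, LinPref.gt, ne_comm, Ne,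
    Z.assignment_eq_some_iff]

variable {q : I → ℕ} {M : (i : I) → Matroid (ContractsOf inst i)}
  {prio : (i : I) → LinPref (ContractsOf inst i)}

theorem substitutesLAD_matroidChoice (hE : ∀ i, (M i).E = Set.univ)
    (hq : ∀ i, ∀ Y : Finset (ContractsOf inst i), (M i).Indep Y → Y.card ≤ q i) :
    SubstitutesLAD fun i => matroidChoice (M i) (prio i) (q i) := by
  refine substitutesLAD_of_forall
    (fun i _ _ h x hx hx' => mem_matroidChoose_of_subset (prio i) (hE i) h hx hx')
    fun i Y Y' h => ?_
  change (matroidChoose (M i) (prio i) (q i) Y).card ≤ (matroidChoose (M i) (prio i) (q i) Y').card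
  rw [card_matroidChoose (prio i) (hE i) (hq i), card_matroidChoose (prio i) (hE i) (hq i)]
  exact min_le_min_left _ (Finset.card_le_card h)

/-- At each institution, this is `matroidChoose_eq_iff` with `Y` its part of `weakUpper R Z` and `X`
its part of `Z`. -/
theorem stable_matroidChoice_iff (hE : ∀ i, (M i).E = Set.univ)
    (hq : ∀ i, ∀ Y : Finset (ContractsOf inst i), (M i).Indep Y → Y.card ≤ q i)
    (R : Problem agent) (Z : Matching agent) :
    Stable (fun i => matroidChoice (M i) (prio i) (q i)) R Z ↔
      NonWasteful inst q R Z ∧ NoJustifiedEnvyUnderRank inst M prio R Z ∧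
        MatroidalObjectives inst M R Z ∧ IndividuallyRational R Z := by
  have key : accepted (fun i => matroidChoice (M i) (prio i) (q i)) (weakUpper R Z) =
      Z.contracts ↔ NonWasteful inst q R Z ∧ NoJustifiedEnvyUnderRank inst M prio R Z ∧
        MatroidalObjectives inst M R Z := by
    rw [eq_iff_part_eq (inst := inst), NonWasteful, NoJustifiedEnvyUnderRank,
      MatroidalObjectives, ← forall_and, ← forall_and]
    refine forall_congr' fun i => ?_
    rw [part_accepted]
    refine (matroidChoose_eq_iff (prio i) (hE i) (hq i)
      (part_mono (contracts_subset_weakUpper R Z) i)).trans ?_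
    simp only [prefers_iff, mem_part]
    refine and_congr (and_congr_right fun _ => ?_) (and_congr ?_ ?_)
    · exact forall_congr' fun y => ⟨fun h h' => h h'.1 h'.2, fun h h1 h2 => h ⟨h1, h2⟩⟩
    · exact forall_congr' fun x => forall_congr' fun _ => forall_congr' fun y =>
        ⟨fun h h1 h2 => h h2.1 h1, fun h h1 h2 => h h2 ⟨h1, h2⟩⟩
    · exact forall_congr' fun y => ⟨fun h h1 h2 => h h2.1 h1, fun h h1 h2 => h h2 ⟨h1, h2⟩⟩
  constructor
  · rintro ⟨h1, h2⟩
    obtain ⟨h3, h4, h5⟩ := key.1 h2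
    exact ⟨h3, h4, h5, h1⟩
  · rintro ⟨h3, h4, h5, h1⟩
    exact ⟨h1, key.2 ⟨h3, h4, h5⟩⟩

end Characterization

end

end MatroidDA

open MatroidDA
theorem mainTheorem5 {A I X : Type*} [Fintype X] (agent : X → A) (inst : X → I)
    (q : I → ℕ)
    (M : (i : I) → Matroid (ContractsOf inst i))
    (hE : ∀ i, (M i).E = Set.univ)
    (hq : ∀ i, ∀ Y : Finset (ContractsOf inst i), (M i).Indep Y → Y.card ≤ q i)
    (prio : (i : I) → LinPref (ContractsOf inst i))
    (φ : MatchingRule agent) :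
    ((∀ R, NonWasteful inst q R (φ R)) ∧
      (∀ R, NoJustifiedEnvyUnderRank inst M prio R (φ R)) ∧
      (∀ R, MatroidalObjectives inst M R (φ R)) ∧
      (∀ R, IndividuallyRational R (φ R)) ∧
      StrategyProof φ) ↔
    φ = daRule (fun i => matroidChoice (M i) (prio i) (q i)) := by
  have hC := substitutesLAD_matroidChoice (prio := prio) hE hq
  constructor
  · rintro ⟨h1, h2, h3, h4, h5⟩
    exact eq_daRule_of_stable_of_strategyProof hC
      (fun R => (stable_matroidChoice_iff hE hq R _).2 ⟨h1 R, h2 R, h3 R, h4 R⟩) h5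
  · rintro rfl
    have h := fun R : Problem agent =>
      (stable_matroidChoice_iff hE hq R _).1 (daRule_stable hC R)
    exact ⟨fun R => (h R).1, fun R => (h R).2.1, fun R => (h R).2.2.1, fun R => (h R).2.2.2,
      daRule_strategyProof hC⟩
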